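/- Let $K\subset\mathbb R^2_q$ be the regular pentagon with vertices $v_k=(\cos\frac{2\pi k}{5},\sin\frac{2\pi k}{5})$, $0\le k\le 4$, and let $T\subset\mathbb R^2_p$ be its rotation by $90^\circ$, with vertices $w_k=(\cos(-\frac{\pi}{2}+\frac{2\pi k}{5}),\sin(-\frac{\pi}{2}+\frac{2\pi k}{5}))$, $0\le k\le 4$. For a convex set $S\subset\mathbb R^N$ and $x\in\partial S$ let $N_S(x)=\{u : \langle u,y-x\rangle\le 0\ \text{for all } y\in S\}$ be the outer normal cone, and let $h_T(u)=\sup_{x\in T}\langle x,u\rangle$ be the support function of $T$. The $T^\circ$-length of a closed polygon with vertices $q_1,\dots,q_m$ is $\sum_{i=1}^m h_T(q_{i+1}-q_i)$, with indices modulo $m$. Such a polygon, with $m\ge 2$, vertices $q_i\in\partial K$ and $q_{i+1}\ne q_i$, is a closed $m$-bounce $T$-billiard trajectory in $K$ if there are $p_1,\dots,p_m\in\partial T$ with $q_{j+1}-q_j\in N_T(p_j)$ and $p_{j+1}-p_j\in -N_K(q_{j+1})$ for every $j$. On $\mathbb R^4=\mathbb R^2_q\oplus\mathbb R^2_p$ put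 $J(q,p)=(p,-q)$. A generalized closed characteristic on the boundary of a bounded convex set $S\subset\mathbb R^4$ with nonempty interior is an absolutely continuous loop $\gamma=(q,p):[0,1]\to\partial S$, $\gamma(0)=\gamma(1)$, such that for almost every $t$ one has $\dot\gamma(t)=Jv$ for some nonzero $v\in N_S(\gamma(t))$; its action is $\int_0^1\langle p(t),\dot q(t)\rangle\,dt$. The Ekeland--Hofer--Zehnder capacity $c_{\mathrm{EHZ}}(S)$ is the minimal action among the generalized closed characteristics on $\partial S$. **Proposition.** The minimum defining $c_{\mathrm{EHZ}}(K\times T)$ is attained. For every diagonal $[v_i,v_j]$ of $K$ ($v_i,v_j$ distinct and non-adjacent vertices), the closed polygon with vertices $q_1=v_i$, $q_2=v_j$ is a closed $2$-bounce $T$-billiard trajectory in $K$, and $c_{\mathrm{EHZ}}(K\times T)$ equals its $T^\circ$-length; explicitly, $$c_{\mathrm{EHZ}}(K\times T)=2\cos\Bigl(\frac{\pi}{10}\Bigr)\Bigl(1+\cos\Bigl(\frac{\pi}{5}\Bigr)\Bigr).$$ -/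

import Mathlib

open Set MeasureTheory

noncomputable section

/-- The configuration (or momentum) space `ℝⁿ` with its Euclidean structure. -/
abbrev Euc (n : ℕ) : Type := EuclideanSpace ℝ (Fin n)

/-- The classical phase space `ℝ²ⁿ = ℝⁿ_q ⊕ ℝⁿ_p`.  A point `z = (q, p)` has `q = z.1` and
`p = z.2`.  Only the topology and the differentiable structure of this product are used; the
Euclidean inner product of `ℝ²ⁿ` is written out where it is needed. -/
abbrev PhaseSpace (n : ℕ) : Type := Euc n × Euc n

/-- The standard complex structure `J (q, p) = (p, -q)`, `J² = -Id`, so that Hamilton's equations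
`q' = ∂H/∂p`, `p' = -∂H/∂q` read `z' = J ∇H(z)`. -/
def stdJ {n : ℕ} (z : PhaseSpace n) : PhaseSpace n := (z.2, -z.1)

/-- The Lagrangian product `K × T ⊆ ℝⁿ_q ⊕ ℝⁿ_p`. -/
def lagrangianProduct {n : ℕ} (K T : Set (Euc n)) : Set (PhaseSpace n) :=
  {z | z.1 ∈ K ∧ z.2 ∈ T}

/-- The outer normal cone `N_K(x) = {u | ⟨u, y - x⟩ ≤ 0 for all y ∈ K}` in `ℝⁿ`. -/
def outerNormalCone {n : ℕ} (K : Set (Euc n)) (x : Euc n) : Set (Euc n) :=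
  {u | ∀ y ∈ K, inner ℝ u (y - x) ≤ 0}

/-- The outer normal cone `N_S(z) = {u | ⟨u, w - z⟩ ≤ 0 for all w ∈ S}` in the phase space, for the
Euclidean inner product `⟨(a, b), (q, p)⟩ = ⟨a, q⟩ + ⟨b, p⟩` of `ℝ²ⁿ`. -/
def phaseNormalCone {n : ℕ} (S : Set (PhaseSpace n)) (z : PhaseSpace n) : Set (PhaseSpace n) :=
  {u | ∀ w ∈ S, inner ℝ u.1 (w.1 - z.1) + inner ℝ u.2 (w.2 - z.2) ≤ 0}

/-- Generalized closed characteristics on the boundary of a convex domain `S`: absolutely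
continuous loops `γ : [0, 1] → ∂S` whose velocity is, for almost every time, of the form `J v`
with `v` a nonzero outer normal vector of `S` at `γ t`.  (The nonzero outer normals at a boundary
point are exactly the positive multiples of the subgradients of a convex function which has `S` as
a regular sublevel set, such as the gauge function of `S` when `0` is interior to `S`.) -/
structure IsGenClosedCharacteristic {n : ℕ} (S : Set (PhaseSpace n)) (γ : ℝ → PhaseSpace n) :
    Prop where
  absolutelyContinuous : AbsolutelyContinuousOnInterval γ 0 1
  closed : γ 0 = γ 1
  mem_frontier : ∀ t ∈ Icc (0 : ℝ) 1, γ t ∈ frontier S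
  velocity : ∀ᵐ t ∂(volume.restrict (Icc (0 : ℝ) 1)),
    ∃ v ∈ phaseNormalCone S (γ t), v ≠ 0 ∧ HasDerivAt γ (stdJ v) t

/-- The symplectic action `∫_γ λ` of a loop `γ`, where `λ = ∑ pᵢ dqᵢ` is a primitive of the
standard symplectic form `∑ dpᵢ ∧ dqᵢ`. -/
def symplecticAction {n : ℕ} (γ : ℝ → PhaseSpace n) : ℝ :=
  ∫ t in (0 : ℝ)..1, inner ℝ (γ t).2 (deriv γ t).1

/-- The set of actions of the generalized closed characteristics on the boundary of `S`. -/
def characteristicActions {n : ℕ} (S : Set (PhaseSpace n)) : Set ℝ :=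
  {a | ∃ γ : ℝ → PhaseSpace n, IsGenClosedCharacteristic S γ ∧ symplecticAction γ = a}

/-- The Ekeland--Hofer--Zehnder capacity of a convex domain `S`: the minimal action among the
generalized closed characteristics on the boundary of `S`. -/
def ehzCapacity {n : ℕ} (S : Set (PhaseSpace n)) : ℝ :=
  sInf (characteristicActions S)

/-- The support function `h_T(u) = sup {⟨x, u⟩ | x ∈ T}`. -/
def supportFn {n : ℕ} (T : Set (Euc n)) (u : Euc n) : ℝ :=
  sSup ((fun x => inner ℝ x u) '' T)

/-- The `T°`-length `∑ h_T(q_{i+1} - q_i)` of the closed polygon with vertices `q`; the addition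
of the indices in `Fin m` is cyclic. -/
def dualLength {n m : ℕ} [NeZero m] (T : Set (Euc n)) (q : Fin m → Euc n) : ℝ :=
  ∑ i, supportFn T (q (i + 1) - q i)

/-- The closed polygon with vertices `q` is a closed `T`-billiard trajectory in `K`; the addition
of the indices in `Fin m` is cyclic, and consecutive vertices are distinct. -/
def IsClosedBilliard {n m : ℕ} [NeZero m] (K T : Set (Euc n)) (q : Fin m → Euc n) : Prop :=
  2 ≤ m ∧ (∀ j, q j ∈ frontier K) ∧ (∀ j, q (j + 1) ≠ q j) ∧
    ∃ p : Fin m → Euc n, (∀ j, p j ∈ frontier T) ∧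
      ∀ j, q (j + 1) - q j ∈ outerNormalCone T (p j) ∧
        -(p (j + 1) - p j) ∈ outerNormalCone K (q (j + 1))

/-- The vertex `(cos (2πk/5), sin (2πk/5))`. -/
def pentagonVertex (k : Fin 5) : Euc 2 :=
  !₂[Real.cos (2 * Real.pi * ((k : ℕ) : ℝ) / 5), Real.sin (2 * Real.pi * ((k : ℕ) : ℝ) / 5)]

/-- The vertex `(cos (-π/2 + 2πk/5), sin (-π/2 + 2πk/5))`. -/
def rotatedPentagonVertex (k : Fin 5) : Euc 2 :=
  !₂[Real.cos (-(Real.pi / 2) + 2 * Real.pi * ((k : ℕ) : ℝ) / 5),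
    Real.sin (-(Real.pi / 2) + 2 * Real.pi * ((k : ℕ) : ℝ) / 5)]

/-- The regular pentagon `K` inscribed in the unit circle. -/
def pentagonK : Set (Euc 2) := convexHull ℝ (range pentagonVertex)

/-- The rotation `T` of `K` by 90 degrees. -/
def pentagonT : Set (Euc 2) := convexHull ℝ (range rotatedPentagonVertex)

end

/-! ### Absolutely continuous curves -/

/-! Write c = cos(2π/5), s = sin(2π/5); the claimed value is 2s(3/2 + c). Lower bound. Along a
characteristic γ = (q, p) one has q' = b and p' = -a with b normal to T at p and a normal to K at q.
Hence the action density is h_T(q'), and each arc has action at least ⟨w, Δq⟩ for every w in T.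
Consider which edge lines of K the curve q meets, labelling an edge by its opposite vertex. If all
labels lie among k-1, k, k+1, every nonzero normal a has ⟨v_k, a⟩ < 0. Then ⟨v_k, p⟩ is monotone on
a loop, so a = 0 almost everywhere, p is constant, and ⟨p, q⟩ increases strictly, which is absurd
(`false_of_normals_one_sided`). Otherwise q meets the edges j, j+2, j+3 for some j. The triangle
w_{j-1}, w_j, w_{j+1} in T has sides normal to these edges, so the three-point bound with these w's
depends only on the edge lines and equals the claimed value. If the edges are met in the other
cyclic order, w_j is replaced by its reflection in the opposite side of the triangle, which still
lies in T. Upper bound. A diagonal of K is parallel to the axis of T through some w_a. Bouncing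
along it, with momenta w_a and the midpoint of the opposite edge of T, gives a rectangular
characteristic of exactly this action (`diagonal_bounce`). -/

theorem AbsolutelyContinuousOnInterval.comp_lipschitzWith {X Y : Type*} [PseudoMetricSpace X]
    [PseudoMetricSpace Y] {f : ℝ → X} {a b : ℝ} (hf : AbsolutelyContinuousOnInterval f a b)
    {g : X → Y} {C : NNReal} (hg : LipschitzWith C g) :
    AbsolutelyContinuousOnInterval (fun t => g (f t)) a b := by
  unfold AbsolutelyContinuousOnInterval at hf ⊢
  refine squeeze_zero (fun E => Finset.sum_nonneg fun _ _ => dist_nonneg) (fun E => ?_)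
    (by simpa using hf.const_mul (C : ℝ))
  rw [Finset.mul_sum]
  exact Finset.sum_le_sum fun i _ => hg.dist_le_mul _ _

theorem AbsolutelyContinuousOnInterval.inner_fst {n : ℕ} {γ : ℝ → PhaseSpace n} {a b : ℝ}
    (hγ : AbsolutelyContinuousOnInterval γ a b) (w : Euc n) :
    AbsolutelyContinuousOnInterval (fun t => inner ℝ w (γ t).1) a b :=
  hγ.comp_lipschitzWith (g := fun z => innerSL ℝ w z.1)
    ((innerSL ℝ w).lipschitz.comp LipschitzWith.prod_fst)

theorem AbsolutelyContinuousOnInterval.inner_snd {n : ℕ} {γ : ℝ → PhaseSpace n} {a b : ℝ}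
    (hγ : AbsolutelyContinuousOnInterval γ a b) (w : Euc n) :
    AbsolutelyContinuousOnInterval (fun t => inner ℝ w (γ t).2) a b :=
  hγ.comp_lipschitzWith (g := fun z => innerSL ℝ w z.2)
    ((innerSL ℝ w).lipschitz.comp LipschitzWith.prod_snd)

theorem hasDerivAt_inner_fst {n : ℕ} {γ : ℝ → PhaseSpace n} {v : PhaseSpace n} {t : ℝ}
    (h : HasDerivAt γ v t) (w : Euc n) :
    HasDerivAt (fun t => inner ℝ w (γ t).1) (inner ℝ w v.1) t :=
  (innerSL ℝ w).hasFDerivAt.comp_hasDerivAt t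
    ((ContinuousLinearMap.fst ℝ (Euc n) (Euc n)).hasFDerivAt.comp_hasDerivAt t h)

theorem hasDerivAt_inner_snd {n : ℕ} {γ : ℝ → PhaseSpace n} {v : PhaseSpace n} {t : ℝ}
    (h : HasDerivAt γ v t) (w : Euc n) :
    HasDerivAt (fun t => inner ℝ w (γ t).2) (inner ℝ w v.2) t :=
  (innerSL ℝ w).hasFDerivAt.comp_hasDerivAt t
    ((ContinuousLinearMap.snd ℝ (Euc n) (Euc n)).hasFDerivAt.comp_hasDerivAt t h)

/-- The action density of an absolutely continuous curve that is almost everywhere differentiable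
is integrable. -/
theorem AbsolutelyContinuousOnInterval.intervalIntegrable_action {n : ℕ} {γ : ℝ → PhaseSpace n}
    (hγ : AbsolutelyContinuousOnInterval γ 0 1)
    (hd : ∀ᵐ t ∂(volume.restrict (Icc (0 : ℝ) 1)), DifferentiableAt ℝ γ t) :
    IntervalIntegrable (fun t => inner ℝ (γ t).2 (deriv γ t).1) volume 0 1 := by
  -- In coordinates each summand is a continuous function times the integrable derivative of a real
  -- absolutely continuous function.
  have key : IntervalIntegrable (fun t => ∑ i, inner ℝ (EuclideanSpace.single i (1 : ℝ)) (γ t).2 *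
      deriv (fun s => inner ℝ (EuclideanSpace.single i (1 : ℝ)) (γ s).1) t) volume 0 1 := by
    have := IntervalIntegrable.sum (μ := volume) (a := 0) (b := 1) Finset.univ
      (f := fun i t => inner ℝ (EuclideanSpace.single i (1 : ℝ)) (γ t).2 *
      deriv (fun s => inner ℝ (EuclideanSpace.single i (1 : ℝ)) (γ s).1) t)
      (fun i _ => ((hγ.inner_fst _).intervalIntegrable_deriv).continuousOn_mul
        (hγ.inner_snd _).continuousOn)
    simpa only [Finset.sum_fn] using this
  refine key.congr_ae ?_
  rw [uIoc_of_le zero_le_one]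
  filter_upwards [ae_restrict_of_ae_restrict_of_subset Ioc_subset_Icc_self hd] with t ht
  have : ∀ i, deriv (fun s => inner ℝ (EuclideanSpace.single i (1 : ℝ)) (γ s).1) t
      = (deriv γ t).1 i := fun i => by
    rw [(hasDerivAt_inner_fst ht.hasDerivAt _).deriv]
    exact (EuclideanSpace.inner_single_left i 1 _).trans (by simp)
  simp only [this]
  simp [PiLp.inner_apply, mul_comm]

/-! ### Closed characteristics on Lagrangian products -/

namespace IsGenClosedCharacteristic

variable {n : ℕ} {K T : Set (Euc n)} {γ : ℝ → PhaseSpace n}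

theorem mem_prod (h : IsGenClosedCharacteristic (lagrangianProduct K T) γ) (hK : IsClosed K)
    (hT : IsClosed T) {t : ℝ} (ht : t ∈ Icc (0 : ℝ) 1) : (γ t).1 ∈ K ∧ (γ t).2 ∈ T := by
  have hc : IsClosed (lagrangianProduct K T) := hK.prod hT
  exact hc.frontier_subset (h.mem_frontier t ht)

/-- The normal cone of a product splits: test v against points of K × T that share one coordinate
with γ t. Then J exchanges the two factors. -/
theorem ae_velocity (h : IsGenClosedCharacteristic (lagrangianProduct K T) γ) (hK : IsClosed K)
    (hT : IsClosed T) : ∀ᵐ t ∂(volume.restrict (Icc (0 : ℝ) 1)), t ∈ Icc (0 : ℝ) 1 ∧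
      ∃ a ∈ outerNormalCone K (γ t).1, ∃ b ∈ outerNormalCone T (γ t).2, (a = 0 → b ≠ 0) ∧
        HasDerivAt γ (b, -a) t := by
  filter_upwards [h.velocity, ae_restrict_mem measurableSet_Icc] with t ⟨v, hv, hv0, hd⟩ ht
  obtain ⟨hq, hp⟩ := h.mem_prod hK hT ht
  refine ⟨ht, v.1, fun y hy => ?_, v.2, fun y hy => ?_, fun h1 h2 => hv0 (Prod.ext h1 h2), hd⟩
  · simpa using hv (y, (γ t).2) ⟨hy, hp⟩
  · simpa using hv ((γ t).1, y) ⟨hq, hy⟩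

theorem intervalIntegrable_action (h : IsGenClosedCharacteristic (lagrangianProduct K T) γ)
    {s t : ℝ} (hs : s ∈ Icc (0 : ℝ) 1) (ht : t ∈ Icc (0 : ℝ) 1) :
    IntervalIntegrable (fun t => inner ℝ (γ t).2 (deriv γ t).1) volume s t := by
  refine (h.absolutelyContinuous.intervalIntegrable_action ?_).mono_set ?_
  · filter_upwards [h.velocity] with t ⟨v, _, _, hd⟩ using hd.differentiableAt
  · rw [uIcc_of_le (zero_le_one' ℝ)]
    exact uIcc_subset_Icc hs ht

/-- The action of an arc dominates `⟨w, ·⟩` of its displacement, for every `w ∈ T`. -/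
theorem inner_sub_le_integral (h : IsGenClosedCharacteristic (lagrangianProduct K T) γ)
    (hK : IsClosed K) (hT : IsClosed T) {w : Euc n} (hw : w ∈ T) {s t : ℝ}
    (hs : 0 ≤ s) (hst : s ≤ t) (ht : t ≤ 1) :
    inner ℝ w ((γ t).1 - (γ s).1) ≤ ∫ τ in s..t, inner ℝ (γ τ).2 (deriv γ τ).1 := by
  have hac : AbsolutelyContinuousOnInterval (fun t => inner ℝ w (γ t).1) s t :=
    (h.absolutelyContinuous.inner_fst w).mono (by
      rw [uIcc_of_le hst, uIcc_of_le zero_le_one]; exact Icc_subset_Icc hs ht)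
  rw [inner_sub_right, ← hac.integral_deriv_eq_sub]
  refine intervalIntegral.integral_mono_ae_restrict hst hac.intervalIntegrable_deriv
    (h.intervalIntegrable_action ⟨hs, hst.trans ht⟩ ⟨hs.trans hst, ht⟩) ?_
  filter_upwards [ae_restrict_of_ae_restrict_of_subset (Icc_subset_Icc hs ht)
    (h.ae_velocity hK hT)] with τ ⟨_, a, _, b, hb, _, hd⟩
  rw [(hasDerivAt_inner_fst hd w).deriv, hd.deriv]
  -- Normality of b to T at p says ⟨w, b⟩ ≤ ⟨p, b⟩, which compares the integrands.
  have := hb w hw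
  rw [inner_sub_right] at this
  simp only [real_inner_comm b]
  linarith [real_inner_comm b w, real_inner_comm b (γ τ).2]

/-- A lower bound for the action in terms of three successive points of the loop. -/
theorem three_point_bound (h : IsGenClosedCharacteristic (lagrangianProduct K T) γ)
    (hK : IsClosed K) (hT : IsClosed T) {w₁ w₂ w₃ : Euc n} (hw₁ : w₁ ∈ T) (hw₂ : w₂ ∈ T)
    (hw₃ : w₃ ∈ T) {t₁ t₂ t₃ : ℝ} (h0 : 0 ≤ t₁) (h12 : t₁ ≤ t₂) (h23 : t₂ ≤ t₃) (h1 : t₃ ≤ 1) :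
    inner ℝ (w₃ - w₁) (γ t₁).1 + inner ℝ (w₁ - w₂) (γ t₂).1 + inner ℝ (w₂ - w₃) (γ t₃).1 ≤
      symplecticAction γ := by
  -- The first and last arcs use the same w₃: since γ 0 = γ 1 they form a single arc from t₃ round
  -- to t₁.
  have i₀ := h.inner_sub_le_integral hK hT hw₃ le_rfl h0 (h12.trans (h23.trans h1))
  have i₁ := h.inner_sub_le_integral hK hT hw₁ h0 h12 (h23.trans h1)
  have i₂ := h.inner_sub_le_integral hK hT hw₂ (h0.trans h12) h23 h1
  have i₃ := h.inner_sub_le_integral hK hT hw₃ (h0.trans (h12.trans h23)) h1 le_rfl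
  have m₀ : (0 : ℝ) ∈ Icc (0 : ℝ) 1 := by simp
  have m₄ : (1 : ℝ) ∈ Icc (0 : ℝ) 1 := by simp
  have m₁ : t₁ ∈ Icc (0 : ℝ) 1 := ⟨by linarith, by linarith⟩
  have m₂ : t₂ ∈ Icc (0 : ℝ) 1 := ⟨by linarith, by linarith⟩
  have m₃ : t₃ ∈ Icc (0 : ℝ) 1 := ⟨by linarith, by linarith⟩
  rw [symplecticAction,
    ← intervalIntegral.integral_add_adjacent_intervals (h.intervalIntegrable_action m₀ m₁)
      (h.intervalIntegrable_action m₁ m₄),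
    ← intervalIntegral.integral_add_adjacent_intervals (h.intervalIntegrable_action m₁ m₂)
      (h.intervalIntegrable_action m₂ m₄),
    ← intervalIntegral.integral_add_adjacent_intervals (h.intervalIntegrable_action m₂ m₃)
      (h.intervalIntegrable_action m₃ m₄)]
  have hcl : inner ℝ w₃ (γ 0).1 = inner ℝ w₃ (γ 1).1 := by rw [h.closed]
  simp only [inner_sub_left, inner_sub_right] at *
  linarith

/-- Three points on a loop are met in one of the two cyclic orders. -/
theorem three_point_bound_or (h : IsGenClosedCharacteristic (lagrangianProduct K T) γ)
    (hK : IsClosed K) (hT : IsClosed T) {t₁ t₂ t₃ : ℝ} (h₁ : t₁ ∈ Icc (0 : ℝ) 1)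
    (h₂ : t₂ ∈ Icc (0 : ℝ) 1) (h₃ : t₃ ∈ Icc (0 : ℝ) 1) :
    (∀ w₁ ∈ T, ∀ w₂ ∈ T, ∀ w₃ ∈ T, inner ℝ (w₃ - w₁) (γ t₁).1 + inner ℝ (w₁ - w₂) (γ t₂).1 +
      inner ℝ (w₂ - w₃) (γ t₃).1 ≤ symplecticAction γ) ∨
    (∀ w₁ ∈ T, ∀ w₂ ∈ T, ∀ w₃ ∈ T, inner ℝ (w₁ - w₃) (γ t₁).1 + inner ℝ (w₂ - w₁) (γ t₂).1 +
      inner ℝ (w₃ - w₂) (γ t₃).1 ≤ symplecticAction γ) := by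
  -- Cyclic shifts of t₁, t₂, t₃ give the first alternative, reversed orders the second. In two of
  -- the eight cases all three times coincide.
  rcases le_total t₁ t₂ with h12 | h12 <;> rcases le_total t₂ t₃ with h23 | h23 <;>
    rcases le_total t₁ t₃ with h13 | h13
  · exact .inl fun w₁ m₁ w₂ m₂ w₃ m₃ => by
      linarith [h.three_point_bound hK hT m₁ m₂ m₃ h₁.1 h12 h23 h₃.2]
  · exact .inl fun w₁ m₁ w₂ m₂ w₃ m₃ => by
      linarith [h.three_point_bound hK hT m₁ m₂ m₃ h₁.1 h12 h23 h₃.2]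
  · exact .inr fun w₁ m₁ w₂ m₂ w₃ m₃ => by
      linarith [h.three_point_bound hK hT m₃ m₂ m₁ h₁.1 h13 h23 h₂.2]
  · exact .inl fun w₁ m₁ w₂ m₂ w₃ m₃ => by
      linarith [h.three_point_bound hK hT m₃ m₁ m₂ h₃.1 h13 h12 h₂.2]
  · exact .inr fun w₁ m₁ w₂ m₂ w₃ m₃ => by
      linarith [h.three_point_bound hK hT m₁ m₃ m₂ h₂.1 h12 h13 h₃.2]
  · exact .inl fun w₁ m₁ w₂ m₂ w₃ m₃ => by
      linarith [h.three_point_bound hK hT m₂ m₃ m₁ h₂.1 h23 h13 h₁.2]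
  · exact .inr fun w₁ m₁ w₂ m₂ w₃ m₃ => by
      linarith [h.three_point_bound hK hT m₂ m₁ m₃ h₃.1 h23 h12 h₁.2]
  · exact .inr fun w₁ m₁ w₂ m₂ w₃ m₃ => by
      linarith [h.three_point_bound hK hT m₂ m₁ m₃ h₃.1 h23 h12 h₁.2]

/-- If `T` has interior around the origin, the normals of `K` along a closed characteristic cannot
all lie strictly on one side of a line. -/
theorem false_of_normals_one_sided (h : IsGenClosedCharacteristic (lagrangianProduct K T) γ)
    (hK : IsClosed K) (hT : IsClosed T) (hT0 : ∀ u : Euc n, u ≠ 0 → ∃ w ∈ T, 0 < inner ℝ w u)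
    (x : Euc n) (hx : ∀ t ∈ Icc (0 : ℝ) 1, ∀ a ∈ outerNormalCone K (γ t).1, a ≠ 0 →
      inner ℝ x a < 0) : False := by
  have hac := h.absolutelyContinuous
  have hv := h.ae_velocity hK hT
  have hv' := ae_restrict_of_ae_restrict_of_subset Ioc_subset_Icc_self hv
  -- ⟨x, p⟩ has derivative -⟨x, a⟩ ≥ 0 and returns to its initial value, so the derivative vanishes
  -- almost everywhere; this forces a = 0.
  have ha : ∀ᵐ t ∂(volume.restrict (Ioc (0 : ℝ) 1)), deriv (fun t => inner ℝ x (γ t).2) t = 0 := by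
    have h0 := (hac.inner_snd x).integral_deriv_eq_sub
    rw [h.closed, sub_self, intervalIntegral.integral_of_le zero_le_one,
      integral_eq_zero_iff_of_nonneg_ae] at h0
    · exact h0
    · filter_upwards [hv'] with t ⟨ht, a, ha, b, _, _, hd⟩
      rw [(hasDerivAt_inner_snd hd x).deriv]
      by_cases h0 : a = 0
      · simp [h0]
      · simpa using (hx t ht a ha h0).le
    · exact ((hac.inner_snd x).intervalIntegrable_deriv).1
  have hp' : ∀ᵐ t ∂(volume.restrict (Ioc (0 : ℝ) 1)), ∃ b ∈ outerNormalCone T (γ t).2, b ≠ 0 ∧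
      HasDerivAt γ (b, 0) t := by
    filter_upwards [ha, hv'] with t h0 ⟨ht, a, ha, b, hb, hab, hd⟩
    rw [(hasDerivAt_inner_snd hd x).deriv] at h0
    have ha0 : a = 0 := by
      by_contra hne
      have := hx t ht a ha hne
      simp only [inner_neg_right] at h0
      linarith
    exact ⟨b, hb, hab ha0, by simpa [ha0] using hd⟩
  have hp : ∀ t ∈ Icc (0 : ℝ) 1, (γ t).2 = (γ 0).2 := by
    intro t ht
    refine ext_inner_left ℝ fun w => ?_
    have hact := (hac.inner_snd w).mono (c := 0) (d := t) (by
      rw [uIcc_of_le zero_le_one, uIcc_of_le ht.1]; exact Icc_subset_Icc le_rfl ht.2)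
    have h0 := hact.integral_deriv_eq_sub
    rw [intervalIntegral.integral_of_le ht.1, integral_eq_zero_of_ae] at h0
    · linarith
    · filter_upwards [ae_restrict_of_ae_restrict_of_subset (Ioc_subset_Ioc_right ht.2) hp']
        with s ⟨b, _, _, hd⟩
      rw [(hasDerivAt_inner_snd hd w).deriv]
      simp
  -- With p constant, ⟨p, q⟩ has derivative ⟨p, b⟩ ≥ ⟨w, b⟩ > 0, although q is closed.
  have hpos : ∀ᵐ t ∂(volume.restrict (Ioc (0 : ℝ) 1)),
      0 < deriv (fun t => inner ℝ (γ 0).2 (γ t).1) t := by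
    filter_upwards [hp', hv'] with t ⟨b, hb, hb0, hd⟩ ⟨ht, _⟩
    rw [(hasDerivAt_inner_fst hd _).deriv, ← hp t ht]
    obtain ⟨w, hw, hwb⟩ := hT0 b hb0
    have := hb w hw
    rw [inner_sub_right, real_inner_comm, real_inner_comm (γ t).2] at this
    simp only
    linarith
  have h0 := (hac.inner_fst (γ 0).2).integral_deriv_eq_sub
  rw [← h.closed, sub_self, intervalIntegral.integral_of_le zero_le_one,
    integral_eq_zero_iff_of_nonneg_ae (hpos.mono fun t ht => ht.le)
    ((hac.inner_fst _).intervalIntegrable_deriv).1] at h0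
  have hf : ∀ᵐ t ∂(volume.restrict (Ioc (0 : ℝ) 1)), False := by
    filter_upwards [h0, hpos] with t h1 h2
    exact h2.ne' h1
  rw [ae_iff] at hf
  simp at hf

end IsGenClosedCharacteristic

/-! ### The regular pentagon -/

noncomputable section

/-- The cosine of the central angle of the pentagon. -/
def pentCos : ℝ := Real.cos (2 * Real.pi / 5)

/-- The sine of the central angle of the pentagon. -/
def pentSin : ℝ := Real.sin (2 * Real.pi / 5)

end

theorem cos_pi_div_five_eq_pentCos : Real.cos (Real.pi / 5) = pentCos + 1 / 2 := by
  have h := Real.quadratic_root_cos_pi_div_five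
  have h2 := Real.cos_two_mul (Real.pi / 5)
  rw [← mul_div_assoc] at h2
  rw [pentCos, h2]
  linarith

/-- This relation and `pentSin_sq` settle the polynomial identities between vertex coordinates
below. -/
theorem pentCos_quadratic : 4 * pentCos ^ 2 + 2 * pentCos = 1 := by
  have h := Real.quadratic_root_cos_pi_div_five
  simp only [cos_pi_div_five_eq_pentCos] at h
  linarith

theorem pentSin_sq : pentSin ^ 2 = 1 - pentCos ^ 2 := Real.sin_sq _

theorem pentCos_pos : 0 < pentCos :=
  Real.cos_pos_of_mem_Ioo ⟨by linarith [Real.pi_pos], by linarith [Real.pi_pos]⟩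

theorem pentSin_pos : 0 < pentSin :=
  Real.sin_pos_of_pos_of_lt_pi (by linarith [Real.pi_pos]) (by linarith [Real.pi_pos])

theorem cos_pi_div_ten_eq_pentSin : Real.cos (Real.pi / 10) = pentSin := by
  rw [pentSin, ← Real.cos_pi_div_two_sub]
  congr 1
  ring

/-! ### Coordinates and inner products of the vertices -/

theorem euc_inner (x y : Euc 2) : inner ℝ x y = x 0 * y 0 + x 1 * y 1 := by
  simp [PiLp.inner_apply, Fin.sum_univ_two, mul_comm]

theorem pentagonVertex_eq : pentagonVertex = ![!₂[1, 0], !₂[pentCos, pentSin],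
    !₂[-(pentCos + 1 / 2), 2 * pentSin * pentCos],
    !₂[-(pentCos + 1 / 2), -(2 * pentSin * pentCos)], !₂[pentCos, -pentSin]] := by
  have e : -(pentCos + 1 / 2) = 2 * pentCos ^ 2 - 1 := by linarith [pentCos_quadratic]
  rw [e]
  funext k
  fin_cases k
  · simp [pentagonVertex]
  · simp [pentagonVertex, pentCos, pentSin]
  · simp only [pentagonVertex, pentCos, pentSin]
    have : 2 * Real.pi * ((2 : ℕ) : ℝ) / 5 = 2 * (2 * Real.pi / 5) := by push_cast; ring
    simp only [this, Real.cos_two_mul, Real.sin_two_mul]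
    simp
  · simp only [pentagonVertex, pentCos, pentSin]
    have : 2 * Real.pi * ((3 : ℕ) : ℝ) / 5 = 2 * Real.pi - 2 * (2 * Real.pi / 5) := by
      push_cast; ring
    simp only [this, Real.cos_two_pi_sub, Real.sin_two_pi_sub, Real.cos_two_mul, Real.sin_two_mul]
    simp
  · simp only [pentagonVertex, pentCos, pentSin]
    have : 2 * Real.pi * ((4 : ℕ) : ℝ) / 5 = 2 * Real.pi - 2 * Real.pi / 5 := by
      push_cast; ring
    simp only [this, Real.cos_two_pi_sub, Real.sin_two_pi_sub]
    simp

theorem rotatedPentagonVertex_eq (k : Fin 5) :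
    rotatedPentagonVertex k = !₂[pentagonVertex k 1, -pentagonVertex k 0] := by
  simp [rotatedPentagonVertex, pentagonVertex, Real.cos_add, Real.sin_add]

theorem inner_pentagonVertex_self (k : Fin 5) :
    inner ℝ (pentagonVertex k) (pentagonVertex k) = 1 := by
  have := pentCos_quadratic
  have := pentSin_sq
  rw [euc_inner, pentagonVertex_eq]
  fin_cases k <;> simp <;> grind

theorem inner_pentagonVertex_add_one (k : Fin 5) :
    inner ℝ (pentagonVertex k) (pentagonVertex (k + 1)) = pentCos := by
  have := pentCos_quadratic
  have := pentSin_sq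
  rw [euc_inner, pentagonVertex_eq]
  fin_cases k <;> simp <;> grind

theorem inner_pentagonVertex_add_two (k : Fin 5) :
    inner ℝ (pentagonVertex k) (pentagonVertex (k + 2)) = -(pentCos + 1 / 2) := by
  have := pentCos_quadratic
  have := pentSin_sq
  rw [euc_inner, pentagonVertex_eq]
  fin_cases k <;> simp <;> grind

/-- The bound is minus the inradius, attained at the two vertices opposite v_i: the outer normal of
that edge is -v_i. -/
theorem le_inner_pentagonVertex (i j : Fin 5) :
    -(pentCos + 1 / 2) ≤ inner ℝ (pentagonVertex i) (pentagonVertex j) := by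
  have hc := pentCos_pos
  obtain h | h | h | h | h : j = i ∨ j = i + 1 ∨ j = i + 2 ∨ i = j + 1 ∨ i = j + 2 := by
    revert i j; decide
  · rw [h, inner_pentagonVertex_self]; linarith
  · rw [h, inner_pentagonVertex_add_one]; linarith
  · rw [h, inner_pentagonVertex_add_two]
  · rw [h, real_inner_comm, inner_pentagonVertex_add_one]; linarith
  · rw [h, real_inner_comm, inner_pentagonVertex_add_two]

theorem inner_pentagonVertex_le_one (i j : Fin 5) :
    inner ℝ (pentagonVertex i) (pentagonVertex j) ≤ 1 := by
  have hc := pentCos_pos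
  have := pentCos_quadratic
  obtain h | h | h | h | h : j = i ∨ j = i + 1 ∨ j = i + 2 ∨ i = j + 1 ∨ i = j + 2 := by
    revert i j; decide
  · rw [h, inner_pentagonVertex_self]
  · rw [h, inner_pentagonVertex_add_one]; nlinarith
  · rw [h, inner_pentagonVertex_add_two]; linarith
  · rw [h, real_inner_comm, inner_pentagonVertex_add_one]; nlinarith
  · rw [h, real_inner_comm, inner_pentagonVertex_add_two]; linarith

theorem inner_rotatedPentagonVertex (i j : Fin 5) :
    inner ℝ (rotatedPentagonVertex i) (rotatedPentagonVertex j) =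
      inner ℝ (pentagonVertex i) (pentagonVertex j) := by
  simp only [euc_inner, rotatedPentagonVertex_eq]
  simp
  ring

theorem sum_pentagonVertex : ∑ k, pentagonVertex k = 0 := by
  rw [pentagonVertex_eq, Fin.sum_univ_five]
  ext i
  fin_cases i <;> simp
  ring

theorem sum_rotatedPentagonVertex : ∑ k, rotatedPentagonVertex k = 0 := by
  simp only [rotatedPentagonVertex_eq]
  rw [pentagonVertex_eq, Fin.sum_univ_five]
  ext i
  fin_cases i <;> simp
  ring

/-! ### The pentagons as convex bodies -/

theorem isClosed_pentagonK : IsClosed pentagonK := (finite_range _).isClosed_convexHull ℝ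

theorem isClosed_pentagonT : IsClosed pentagonT := (finite_range _).isClosed_convexHull ℝ

theorem convex_pentagonK : Convex ℝ pentagonK := convex_convexHull ℝ _

theorem convex_pentagonT : Convex ℝ pentagonT := convex_convexHull ℝ _

theorem pentagonVertex_mem (k : Fin 5) : pentagonVertex k ∈ pentagonK :=
  subset_convexHull ℝ _ ⟨k, rfl⟩

theorem rotatedPentagonVertex_mem (k : Fin 5) : rotatedPentagonVertex k ∈ pentagonT :=
  subset_convexHull ℝ _ ⟨k, rfl⟩

theorem zero_mem_convexHull_of_sum_eq_zero {v : Fin 5 → Euc 2} (hv : ∑ k, v k = 0) :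
    (0 : Euc 2) ∈ convexHull ℝ (range v) := by
  have := (convex_convexHull ℝ (range v)).sum_mem (t := Finset.univ) (w := fun _ => (1 / 5 : ℝ))
    (z := v) (by simp) (by simp) (fun i _ => subset_convexHull ℝ _ ⟨i, rfl⟩)
  rwa [← Finset.smul_sum, hv, smul_zero] at this

theorem Convex.smul_add_smul_mem_of_zero_mem {E : Type*} [AddCommGroup E] [Module ℝ E] {s : Set E}
    (hs : Convex ℝ s) (h0 : (0 : E) ∈ s) {x y : E} (hx : x ∈ s) (hy : y ∈ s) {a b : ℝ}
    (ha : 0 ≤ a) (hb : 0 ≤ b) (hab : a + b ≤ 1) : a • x + b • y ∈ s := by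
  have := hs.sum_mem (t := Finset.univ) (w := ![a, b, 1 - a - b]) (z := ![x, y, 0])
    (by intro i _; fin_cases i <;> simp [ha, hb]; linarith)
    (by simp [Fin.sum_univ_three]) (by intro i _; fin_cases i <;> simp [h0, hx, hy])
  simpa [Fin.sum_univ_three] using this

/-- A linear inequality on the vertices extends to the convex hull. -/
theorem inner_le_of_mem_convexHull {ι : Type*} {v : ι → Euc 2} {u x : Euc 2} {m : ℝ}
    (h : ∀ k, inner ℝ u (v k) ≤ m) (hx : x ∈ convexHull ℝ (range v)) : inner ℝ u x ≤ m := by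
  have hc : Convex ℝ {y : Euc 2 | inner ℝ u y ≤ m} := convex_halfSpace_le (innerₛₗ ℝ u).isLinear m
  exact convexHull_min (by rintro _ ⟨k, rfl⟩; exact h k) hc hx

/-- The pentagon is cut out by the five half-planes bounded by the lines of its edges. -/
theorem mem_pentagonK_iff {x : Euc 2} :
    x ∈ pentagonK ↔ ∀ k, -(pentCos + 1 / 2) ≤ inner ℝ (pentagonVertex k) x := by
  constructor
  · intro hx k
    have := inner_le_of_mem_convexHull (u := -pentagonVertex k) (m := pentCos + 1 / 2)
      (fun j => by rw [inner_neg_left]; linarith [le_inner_pentagonVertex k j]) hx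
    rw [inner_neg_left] at this
    linarith
  · intro h
    have hs := pentSin_pos
    have hc := pentCos_pos
    have hq := pentCos_quadratic
    have hss := pentSin_sq
    -- The cross products v_k × x locate x in a sector spanned by v_k and v_{k+1}. They sum to zero,
    -- so they cannot all be positive or all negative, and the sign must drop somewhere.
    obtain ⟨cr, hcr⟩ : ∃ cr : Fin 5 → ℝ,
        cr = fun k => pentagonVertex k 0 * x 1 - pentagonVertex k 1 * x 0 := ⟨_, rfl⟩
    have hsum : ∑ k, cr k = 0 := by
      rw [hcr, Fin.sum_univ_five, pentagonVertex_eq]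
      simp
      ring
    have hsector : ∃ k, 0 ≤ cr k ∧ cr (k + 1) ≤ 0 := by
      by_contra! hcon
      rw [Fin.sum_univ_five] at hsum
      have h0 := hcon 0
      have h1 := hcon 1
      have h2 := hcon 2
      have h3 := hcon 3
      have h4 := hcon 4
      simp only [zero_add, show (1 + 1 : Fin 5) = 2 from rfl, show (2 + 1 : Fin 5) = 3 from rfl,
        show (3 + 1 : Fin 5) = 4 from rfl, show (4 + 1 : Fin 5) = 0 from rfl] at h0 h1 h2 h3 h4
      grind
    obtain ⟨k, hk, hk1⟩ := hsector
    -- Cramer's rule; s is the determinant of v_k, v_{k+1}.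
    have hx : x = (-cr (k + 1) / pentSin) • pentagonVertex k +
        (cr k / pentSin) • pentagonVertex (k + 1) := by
      have : pentSin • x = (-cr (k + 1)) • pentagonVertex k + cr k • pentagonVertex (k + 1) := by
        rw [hcr, pentagonVertex_eq]
        ext i
        fin_cases i <;> fin_cases k <;> simp <;> grind
      rw [div_eq_inv_mul, div_eq_inv_mul, mul_smul, mul_smul, ← smul_add, ← this,
        inv_smul_smul₀ hs.ne']
    -- The edge [v_k, v_{k+1}] is opposite v_{k+3}; its half-plane bounds the sum of the two
    -- coefficients by 1.
    have hbd : cr k - cr (k + 1) ≤ pentSin := by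
      have := h (k + 3)
      have e : pentSin * inner ℝ (pentagonVertex (k + 3)) x
          = -(pentCos + 1 / 2) * (cr k - cr (k + 1)) := by
        rw [hcr, euc_inner, pentagonVertex_eq]
        fin_cases k <;> simp <;> grind
      have h2 := mul_le_mul_of_nonneg_left this hs.le
      rw [e] at h2
      nlinarith
    rw [hx]
    refine convex_pentagonK.smul_add_smul_mem_of_zero_mem
      (zero_mem_convexHull_of_sum_eq_zero sum_pentagonVertex) (pentagonVertex_mem _)
      (pentagonVertex_mem _) (div_nonneg (by linarith) hs.le) (div_nonneg hk hs.le) ?_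
    rw [← add_div, div_le_one hs]
    linarith

theorem exists_inner_pos_of_ne_zero {u : Euc 2} (hu : u ≠ 0) :
    ∃ w ∈ pentagonT, 0 < inner ℝ w u := by
  by_contra! h
  have hk := fun k => h _ (rotatedPentagonVertex_mem k)
  -- Nonpositive numbers with sum zero all vanish, and w_0, w_1 already span the plane.
  have hs : ∑ k, inner ℝ (rotatedPentagonVertex k) u = 0 := by
    rw [← sum_inner, sum_rotatedPentagonVertex, inner_zero_left]
  have h0 := (Finset.sum_eq_zero_iff_of_nonpos fun k _ => hk k).1 hs
  have hc := pentSin_pos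
  have e0 := h0 0 (Finset.mem_univ _)
  have e1 := h0 1 (Finset.mem_univ _)
  simp [euc_inner, rotatedPentagonVertex_eq, pentagonVertex_eq] at e0 e1
  apply hu
  ext i
  fin_cases i
  · simpa [e0, hc.ne'] using e1
  · simpa using e0

/-- If `x` lies on no edge line except those opposite to three consecutive vertices, then the
outer normals at `x` point away from the middle vertex. -/
theorem inner_neg_of_mem_outerNormalCone {x a : Euc 2} {k : Fin 5} (hx : x ∈ pentagonK)
    (h : ∀ j, inner ℝ (pentagonVertex j) x = -(pentCos + 1 / 2) → j = k - 1 ∨ j = k ∨ j = k + 1)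
    (ha : a ∈ outerNormalCone pentagonK x) (ha0 : a ≠ 0) : inner ℝ (pentagonVertex k) a < 0 := by
  have hc := pentCos_pos
  have hc1 := pentCos_quadratic
  have hna : 0 < ‖a‖ := norm_pos_iff.2 ha0
  have hnv : ∀ j, ‖pentagonVertex j‖ = 1 := fun j => by
    rw [norm_eq_sqrt_real_inner, inner_pentagonVertex_self, Real.sqrt_one]
  -- The direction v_k enters K at x. Tilting it towards a by length c is still harmless, because
  -- ⟨v_j, v_k⟩ ≥ c for the three possible active constraints. Then ⟨a, y⟩ ≤ 0 gives ⟨v_k, a⟩ ≤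
  -- -c‖a‖.
  obtain ⟨y, hy⟩ : ∃ y, y = pentagonVertex k + (pentCos / ‖a‖) • a := ⟨_, rfl⟩
  have hgood : ∀ j, (j = k - 1 ∨ j = k ∨ j = k + 1) → 0 ≤ inner ℝ (pentagonVertex j) y := by
    intro j hj
    have h1 : pentCos ≤ inner ℝ (pentagonVertex j) (pentagonVertex k) := by
      rcases hj with rfl | rfl | rfl
      · have := inner_pentagonVertex_add_one (k - 1)
        rw [sub_add_cancel] at this
        exact this.ge
      · rw [inner_pentagonVertex_self]; nlinarith
      · rw [real_inner_comm, inner_pentagonVertex_add_one]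
    have h2 : -‖a‖ ≤ inner ℝ (pentagonVertex j) a := by
      have := (abs_le.1 (abs_real_inner_le_norm (pentagonVertex j) a)).1
      rwa [hnv, one_mul] at this
    have h3 : pentCos / ‖a‖ * -‖a‖ ≤ pentCos / ‖a‖ * inner ℝ (pentagonVertex j) a :=
      mul_le_mul_of_nonneg_left h2 (by positivity)
    have h4 : pentCos / ‖a‖ * -‖a‖ = -pentCos := by field_simp
    rw [hy, inner_add_right, real_inner_smul_right]
    linarith
  have hev : ∀ᶠ ε in nhdsWithin (0 : ℝ) (Ioi 0), ∀ j : Fin 5,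
      -(pentCos + 1 / 2) ≤ inner ℝ (pentagonVertex j) (x + ε • y) := by
    refine Filter.eventually_all.2 fun j => ?_
    have hxj := mem_pentagonK_iff.1 hx j
    rcases hxj.eq_or_lt with heq | hlt
    · filter_upwards [self_mem_nhdsWithin] with ε hε
      rw [inner_add_right, real_inner_smul_right]
      have := mul_nonneg (le_of_lt hε) (hgood j (h j heq.symm))
      linarith
    -- Inactive constraints survive a small displacement.
    · have hcont : Continuous fun ε : ℝ => inner ℝ (pentagonVertex j) (x + ε • y) := by fun_prop
      have := (hcont.tendsto 0).eventually (lt_mem_nhds (a := -(pentCos + 1 / 2))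
        (by simpa only [zero_smul, add_zero] using hlt))
      exact (this.filter_mono nhdsWithin_le_nhds).mono fun ε h => h.le
  obtain ⟨ε, hε, hpos⟩ := (hev.and self_mem_nhdsWithin).exists
  have hpos : 0 < ε := hpos
  have := ha _ (mem_pentagonK_iff.2 hε)
  rw [add_sub_cancel_left, real_inner_smul_right, hy, inner_add_right, real_inner_smul_right,
    real_inner_self_eq_norm_sq, real_inner_comm] at this
  have h5 : 0 < pentCos / ‖a‖ * ‖a‖ ^ 2 := by positivity
  by_contra! hcon
  nlinarith [mul_pos hpos (add_pos_of_nonneg_of_pos hcon h5)]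

/-- This and the next two lemmas make the sides of the triangle w_{j-1}, w_j, w_{j+1} normal to the
edges of K opposite v_j, v_{j+2}, v_{j+3}. -/
theorem rotatedPentagonVertex_sub_neighbours (j : Fin 5) :
    rotatedPentagonVertex (j + 1) - rotatedPentagonVertex (j - 1) =
      (2 * pentSin) • pentagonVertex j := by
  have := pentCos_quadratic
  have := pentSin_sq
  simp only [rotatedPentagonVertex_eq]
  rw [pentagonVertex_eq]
  ext i
  fin_cases i <;> fin_cases j <;> simp <;> grind

theorem rotatedPentagonVertex_sub_add_two (j : Fin 5) :
    rotatedPentagonVertex (j - 1) - rotatedPentagonVertex j =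
      (4 * pentSin * pentCos) • pentagonVertex (j + 2) := by
  have := pentCos_quadratic
  have := pentSin_sq
  simp only [rotatedPentagonVertex_eq]
  rw [pentagonVertex_eq]
  ext i
  fin_cases i <;> fin_cases j <;> simp <;> grind

theorem rotatedPentagonVertex_sub_add_three (j : Fin 5) :
    rotatedPentagonVertex j - rotatedPentagonVertex (j + 1) =
      (4 * pentSin * pentCos) • pentagonVertex (j + 3) := by
  have := pentCos_quadratic
  have := pentSin_sq
  simp only [rotatedPentagonVertex_eq]
  rw [pentagonVertex_eq]
  ext i
  fin_cases i <;> fin_cases j <;> simp <;> grind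

/-- The reflection of a vertex of the pentagon in the diagonal joining its neighbours. -/
theorem rotatedPentagonVertex_reflect_mem (j : Fin 5) :
    rotatedPentagonVertex (j + 1) + rotatedPentagonVertex (j - 1) - rotatedPentagonVertex j ∈
      pentagonT := by
  have hc := pentCos_pos
  have hq := pentCos_quadratic
  have hss := pentSin_sq
  have e : rotatedPentagonVertex (j + 1) + rotatedPentagonVertex (j - 1) - rotatedPentagonVertex j =
      (4 * pentCos - 1) • rotatedPentagonVertex (j + 2) +
      (4 * pentCos - 1) • rotatedPentagonVertex (j + 3) := by
    simp only [rotatedPentagonVertex_eq]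
    rw [pentagonVertex_eq]
    ext i
    fin_cases i <;> fin_cases j <;> simp <;> grind
  rw [e]
  -- The coefficients are admissible because 1/4 ≤ c ≤ 3/8, by the quadratic equation.
  refine convex_pentagonT.smul_add_smul_mem_of_zero_mem
    (zero_mem_convexHull_of_sum_eq_zero sum_rotatedPentagonVertex) (rotatedPentagonVertex_mem _)
    (rotatedPentagonVertex_mem _) ?_ ?_ ?_ <;> nlinarith

/-! ### The lower bound -/

theorem exists_triple_or_subset_consecutive (P : Fin 5 → Prop) :
    (∃ j, P j ∧ P (j + 2) ∧ P (j + 3)) ∨ ∃ k, ∀ j, P j → j = k - 1 ∨ j = k ∨ j = k + 1 := by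
  have key : ∀ f : Fin 5 → Bool, (∃ j, f j = true ∧ f (j + 2) = true ∧ f (j + 3) = true) ∨
      ∃ k, ∀ j, f j = true → j = k - 1 ∨ j = k ∨ j = k + 1 := by decide
  classical
  simpa using key fun j => decide (P j)

theorem IsGenClosedCharacteristic.pentagon_le_symplecticAction {γ : ℝ → PhaseSpace 2}
    (h : IsGenClosedCharacteristic (lagrangianProduct pentagonK pentagonT) γ) :
    2 * pentSin * (3 / 2 + pentCos) ≤ symplecticAction γ := by
  have hq := pentCos_quadratic
  -- The predicate says that q meets the edge line opposite v_j.
  obtain ⟨j, ⟨t₁, h₁, e₁⟩, ⟨t₂, h₂, e₂⟩, ⟨t₃, h₃, e₃⟩⟩ | ⟨k, hk⟩ :=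
    exists_triple_or_subset_consecutive fun j => ∃ t ∈ Icc (0 : ℝ) 1,
      inner ℝ (pentagonVertex j) (γ t).1 = -(pentCos + 1 / 2)
  · have d₁ := rotatedPentagonVertex_sub_neighbours j
    have d₂ := rotatedPentagonVertex_sub_add_two j
    have d₃ := rotatedPentagonVertex_sub_add_three j
    have total : inner ℝ (rotatedPentagonVertex (j - 1) - rotatedPentagonVertex (j + 1)) (γ t₁).1 +
        inner ℝ (rotatedPentagonVertex j - rotatedPentagonVertex (j - 1)) (γ t₂).1 +
        inner ℝ (rotatedPentagonVertex (j + 1) - rotatedPentagonVertex j) (γ t₃).1 =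
        2 * pentSin * (3 / 2 + pentCos) := by
      rw [← neg_sub, d₁, ← neg_sub (rotatedPentagonVertex (j - 1)), d₂,
        ← neg_sub (rotatedPentagonVertex j), d₃]
      simp only [inner_neg_left, real_inner_smul_left, e₁, e₂, e₃]
      grind
    rw [← total]
    rcases h.three_point_bound_or isClosed_pentagonK isClosed_pentagonT h₁ h₂ h₃ with hb | hb
    -- The parallelogram law: with w_{j+1} + w_{j-1} - w_j as third vertex the same side vectors
    -- occur in the opposite order.
    · have := hb _ (rotatedPentagonVertex_mem (j + 1)) _ (rotatedPentagonVertex_reflect_mem j)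
        _ (rotatedPentagonVertex_mem (j - 1))
      simp only [inner_sub_left, inner_add_left] at this ⊢
      linarith
    · exact hb _ (rotatedPentagonVertex_mem (j - 1)) _ (rotatedPentagonVertex_mem j)
        _ (rotatedPentagonVertex_mem (j + 1))
  · refine (h.false_of_normals_one_sided isClosed_pentagonK isClosed_pentagonT
      (fun u hu => exists_inner_pos_of_ne_zero hu) (pentagonVertex k) fun t ht a ha ha0 => ?_).elim
    exact inner_neg_of_mem_outerNormalCone (h.mem_prod isClosed_pentagonK isClosed_pentagonT ht).1
      (fun j hj => hk j ⟨t, ht, hj⟩) ha ha0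

/-! ### Two-bounce trajectories -/

noncomputable section

/-- The piecewise linear function that rises from `0` to `1` on `[0, 1/4]` and falls back to `0` on
`[1/2, 3/4]`. -/
def trapezoid (t : ℝ) : ℝ := max 0 (min 1 (min (4 * t) (3 - 4 * t)))

/-- The loop that runs through the boundary of a rectangle with corners `(q₁, p₁)`, `(q₂, p₁)`,
`(q₂, p₂)`, `(q₁, p₂)`, in this order. -/
def rectangleLoop {n : ℕ} (q₁ q₂ p₁ p₂ : Euc n) (t : ℝ) : PhaseSpace n :=
  (q₁ + trapezoid t • (q₂ - q₁), p₁ + trapezoid (t - 1 / 4) • (p₂ - p₁))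

end

theorem trapezoid_mem_Icc (t : ℝ) : trapezoid t ∈ Icc (0 : ℝ) 1 := by
  simp [trapezoid]

theorem trapezoid_of_nonpos {t : ℝ} (h : t ≤ 0) : trapezoid t = 0 := by
  grind [trapezoid]

theorem trapezoid_of_mem_rise {t : ℝ} (h : t ∈ Icc (0 : ℝ) (1 / 4)) : trapezoid t = 4 * t := by
  grind [trapezoid]

theorem trapezoid_of_mem_top {t : ℝ} (h : t ∈ Icc (1 / 4 : ℝ) (1 / 2)) : trapezoid t = 1 := by
  grind [trapezoid]

theorem trapezoid_of_mem_fall {t : ℝ} (h : t ∈ Icc (1 / 2 : ℝ) (3 / 4)) :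
    trapezoid t = 3 - 4 * t := by
  grind [trapezoid]

theorem trapezoid_of_le {t : ℝ} (h : 3 / 4 ≤ t) : trapezoid t = 0 := by
  grind [trapezoid]

theorem hasDerivAt_trapezoid_of_neg {t : ℝ} (h : t < 0) : HasDerivAt trapezoid 0 t :=
  (hasDerivAt_const t (0 : ℝ)).congr_of_eventuallyEq <| by
    filter_upwards [Iio_mem_nhds h] with s hs using trapezoid_of_nonpos (le_of_lt hs)

theorem hasDerivAt_trapezoid_of_rise {t : ℝ} (h : t ∈ Ioo (0 : ℝ) (1 / 4)) :
    HasDerivAt trapezoid 4 t :=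
  (show HasDerivAt (fun s : ℝ => 4 * s) 4 t by
    simpa using (hasDerivAt_id t).const_mul 4).congr_of_eventuallyEq <| by
    filter_upwards [Ioo_mem_nhds h.1 h.2] with s hs
      using trapezoid_of_mem_rise (Ioo_subset_Icc_self hs)

theorem hasDerivAt_trapezoid_of_top {t : ℝ} (h : t ∈ Ioo (1 / 4 : ℝ) (1 / 2)) :
    HasDerivAt trapezoid 0 t :=
  (hasDerivAt_const t (1 : ℝ)).congr_of_eventuallyEq <| by
    filter_upwards [Ioo_mem_nhds h.1 h.2] with s hs
      using trapezoid_of_mem_top (Ioo_subset_Icc_self hs)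

theorem hasDerivAt_trapezoid_of_fall {t : ℝ} (h : t ∈ Ioo (1 / 2 : ℝ) (3 / 4)) :
    HasDerivAt trapezoid (-4) t :=
  (show HasDerivAt (fun s : ℝ => 3 - 4 * s) (-4) t by
    simpa using ((hasDerivAt_id t).const_mul 4).const_sub 3).congr_of_eventuallyEq <| by
    filter_upwards [Ioo_mem_nhds h.1 h.2] with s hs
      using trapezoid_of_mem_fall (Ioo_subset_Icc_self hs)

theorem hasDerivAt_trapezoid_of_gt {t : ℝ} (h : 3 / 4 < t) : HasDerivAt trapezoid 0 t :=
  (hasDerivAt_const t (0 : ℝ)).congr_of_eventuallyEq <| by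
    filter_upwards [Ioi_mem_nhds h] with s hs using trapezoid_of_le (le_of_lt hs)

theorem lipschitzWith_trapezoid : LipschitzWith 4 trapezoid := by
  refine LipschitzWith.of_dist_le_mul fun a b => ?_
  simp only [Real.dist_eq, trapezoid]
  norm_num
  grind

section rectangleLoop

variable {n : ℕ} {q₁ q₂ p₁ p₂ : Euc n}

theorem hasDerivAt_rectangleLoop {t a b : ℝ} (ha : HasDerivAt trapezoid a t)
    (hb : HasDerivAt trapezoid b (t - 1 / 4)) :
    HasDerivAt (rectangleLoop q₁ q₂ p₁ p₂) (a • (q₂ - q₁), b • (p₂ - p₁)) t := by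
  have hb' : HasDerivAt (fun s => trapezoid (s - 1 / 4)) b t := hb.comp_sub_const t (1 / 4)
  exact ((ha.smul_const _).const_add _).prodMk ((hb'.smul_const _).const_add _)

theorem absolutelyContinuousOnInterval_rectangleLoop (a b : ℝ) :
    AbsolutelyContinuousOnInterval (rectangleLoop q₁ q₂ p₁ p₂) a b := by
  have h1 : ∀ (x d : Euc n) (c : ℝ),
      LipschitzWith (‖d‖₊ * 4) fun t : ℝ => x + trapezoid (t - c) • d := fun x d c =>
    LipschitzWith.of_dist_le_mul fun s t => by
      have := lipschitzWith_trapezoid.dist_le_mul (s - c) (t - c)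
      rw [dist_sub_right] at this
      rw [dist_add_left, dist_eq_norm, ← sub_smul, norm_smul, ← dist_eq_norm]
      calc _ ≤ ((4 : NNReal) : ℝ) * dist s t * ‖d‖ := by gcongr
        _ = _ := by push_cast; ring
  have h2 := (h1 q₁ (q₂ - q₁) 0).prodMk (h1 p₁ (p₂ - p₁) (1 / 4))
  simp only [sub_zero] at h2
  exact (h2.lipschitzOnWith (s := uIcc a b)).absolutelyContinuousOnInterval

theorem hasDerivAt_rectangleLoop_first {t : ℝ} (h : t ∈ Ioo (0 : ℝ) (1 / 4)) :
    HasDerivAt (rectangleLoop q₁ q₂ p₁ p₂) ((4 : ℝ) • (q₂ - q₁), 0) t := by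
  simpa using hasDerivAt_rectangleLoop (q₁ := q₁) (q₂ := q₂) (p₁ := p₁) (p₂ := p₂)
    (hasDerivAt_trapezoid_of_rise h) (hasDerivAt_trapezoid_of_neg (by linarith [h.2]))

theorem hasDerivAt_rectangleLoop_second {t : ℝ} (h : t ∈ Ioo (1 / 4 : ℝ) (1 / 2)) :
    HasDerivAt (rectangleLoop q₁ q₂ p₁ p₂) (0, (4 : ℝ) • (p₂ - p₁)) t := by
  simpa using hasDerivAt_rectangleLoop (q₁ := q₁) (q₂ := q₂) (p₁ := p₁) (p₂ := p₂)
    (hasDerivAt_trapezoid_of_top h)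
    (hasDerivAt_trapezoid_of_rise ⟨by linarith [h.1], by linarith [h.2]⟩)

theorem hasDerivAt_rectangleLoop_third {t : ℝ} (h : t ∈ Ioo (1 / 2 : ℝ) (3 / 4)) :
    HasDerivAt (rectangleLoop q₁ q₂ p₁ p₂) ((-4 : ℝ) • (q₂ - q₁), 0) t := by
  simpa using hasDerivAt_rectangleLoop (q₁ := q₁) (q₂ := q₂) (p₁ := p₁) (p₂ := p₂)
    (hasDerivAt_trapezoid_of_fall h)
    (hasDerivAt_trapezoid_of_top ⟨by linarith [h.1], by linarith [h.2]⟩)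

theorem hasDerivAt_rectangleLoop_fourth {t : ℝ} (h : t ∈ Ioo (3 / 4 : ℝ) 1) :
    HasDerivAt (rectangleLoop q₁ q₂ p₁ p₂) (0, (-4 : ℝ) • (p₂ - p₁)) t := by
  simpa using hasDerivAt_rectangleLoop (q₁ := q₁) (q₂ := q₂) (p₁ := p₁) (p₂ := p₂)
    (hasDerivAt_trapezoid_of_gt h.1)
    (hasDerivAt_trapezoid_of_fall ⟨by linarith [h.1], by linarith [h.2]⟩)

theorem rectangleLoop_first {t : ℝ} (h : t ∈ Icc (0 : ℝ) (1 / 4)) :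
    (rectangleLoop q₁ q₂ p₁ p₂ t).2 = p₁ := by
  have : trapezoid (t - 1 / 4) = 0 := trapezoid_of_nonpos (by linarith [h.2])
  simp only [rectangleLoop, this]
  simp

theorem rectangleLoop_second {t : ℝ} (h : t ∈ Icc (1 / 4 : ℝ) (1 / 2)) :
    (rectangleLoop q₁ q₂ p₁ p₂ t).1 = q₂ := by
  simp [rectangleLoop, trapezoid_of_mem_top h]

theorem rectangleLoop_third {t : ℝ} (h : t ∈ Icc (1 / 2 : ℝ) (3 / 4)) :
    (rectangleLoop q₁ q₂ p₁ p₂ t).2 = p₂ := by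
  have : trapezoid (t - 1 / 4) = 1 := trapezoid_of_mem_top ⟨by linarith [h.1], by linarith [h.2]⟩
  simp only [rectangleLoop, this]
  simp

theorem rectangleLoop_fourth {t : ℝ} (h : t ∈ Icc (3 / 4 : ℝ) 1) :
    (rectangleLoop q₁ q₂ p₁ p₂ t).1 = q₁ := by
  simp [rectangleLoop, trapezoid_of_le h.1]

theorem mem_Ioo_quarter_of_notMem {t : ℝ} (ht : t ∈ Icc (0 : ℝ) 1)
    (h : t ∉ ({0, 1 / 4, 1 / 2, 3 / 4, 1} : Set ℝ)) :
    t ∈ Ioo (0 : ℝ) (1 / 4) ∨ t ∈ Ioo (1 / 4 : ℝ) (1 / 2) ∨ t ∈ Ioo (1 / 2 : ℝ) (3 / 4) ∨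
      t ∈ Ioo (3 / 4 : ℝ) 1 := by
  simp only [mem_insert_iff, mem_singleton_iff, not_or] at h
  grind

/-- On each quarter of the period one factor rests at a boundary point while the other moves in the
direction allowed by the normal cone there. The corner times form a null set. -/
theorem isGenClosedCharacteristic_rectangleLoop {K T : Set (Euc n)} (hK : Convex ℝ K)
    (hT : Convex ℝ T) (hKc : IsClosed K) (hTc : IsClosed T) (hq₁ : q₁ ∈ frontier K)
    (hq₂ : q₂ ∈ frontier K)
    (hp₁ : p₁ ∈ frontier T) (hp₂ : p₂ ∈ frontier T) (hq : q₂ ≠ q₁) (hp : p₂ ≠ p₁)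
    (h₁ : q₂ - q₁ ∈ outerNormalCone T p₁) (h₂ : -(p₂ - p₁) ∈ outerNormalCone K q₂)
    (h₃ : q₁ - q₂ ∈ outerNormalCone T p₂) (h₄ : -(p₁ - p₂) ∈ outerNormalCone K q₁) :
    IsGenClosedCharacteristic (lagrangianProduct K T) (rectangleLoop q₁ q₂ p₁ p₂) := by
  have hd : q₂ - q₁ ≠ 0 := sub_ne_zero.2 hq
  have he : p₂ - p₁ ≠ 0 := sub_ne_zero.2 hp
  have hmem : ∀ t, (rectangleLoop q₁ q₂ p₁ p₂ t).1 ∈ K ∧ (rectangleLoop q₁ q₂ p₁ p₂ t).2 ∈ T :=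
    fun t => ⟨hK.add_smul_sub_mem (hKc.frontier_subset hq₁) (hKc.frontier_subset hq₂)
      (trapezoid_mem_Icc t), hT.add_smul_sub_mem (hTc.frontier_subset hp₁)
      (hTc.frontier_subset hp₂) (trapezoid_mem_Icc _)⟩
  have hfr : ∀ z : PhaseSpace n, z.1 ∈ K → z.2 ∈ T → (z.1 ∈ frontier K ∨ z.2 ∈ frontier T) →
      z ∈ frontier (lagrangianProduct K T) := by
    intro z hz1 hz2 hz
    change z ∈ frontier (K ×ˢ T)
    rw [frontier_prod_eq]
    rcases hz with hz | hz
    · exact .inr ⟨hz, subset_closure hz2⟩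
    · exact .inl ⟨subset_closure hz1, hz⟩
  refine ⟨absolutelyContinuousOnInterval_rectangleLoop 0 1, ?_, fun t ht => ?_, ?_⟩
  · simp [rectangleLoop, trapezoid]
    norm_num
  · refine hfr _ (hmem t).1 (hmem t).2 ?_
    rcases le_total t (1 / 4) with h | h
    · exact .inr (by rwa [rectangleLoop_first ⟨ht.1, h⟩])
    rcases le_total t (1 / 2) with h' | h'
    · exact .inl (by rwa [rectangleLoop_second ⟨h, h'⟩])
    rcases le_total t (3 / 4) with h'' | h''
    · exact .inr (by rwa [rectangleLoop_third ⟨h', h''⟩])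
    · exact .inl (by rwa [rectangleLoop_fourth ⟨h'', ht.2⟩])
  · filter_upwards [ae_restrict_mem measurableSet_Icc, ae_restrict_of_ae
      ((Set.toFinite ({0, 1 / 4, 1 / 2, 3 / 4, 1} : Set ℝ)).countable.ae_notMem volume)]
      with t ht hnt
    rcases mem_Ioo_quarter_of_notMem ht hnt with h | h | h | h
    · refine ⟨(0, (4 : ℝ) • (q₂ - q₁)), fun w hw => ?_, by simp [hd],
        by simpa [stdJ] using hasDerivAt_rectangleLoop_first h⟩
      rw [rectangleLoop_first (Ioo_subset_Icc_self h)]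
      simp only [inner_zero_left, real_inner_smul_left]
      linarith [h₁ _ hw.2]
    · refine ⟨((-4 : ℝ) • (p₂ - p₁), 0), fun w hw => ?_, by simp [he],
        by simpa [stdJ] using hasDerivAt_rectangleLoop_second h⟩
      rw [rectangleLoop_second (Ioo_subset_Icc_self h)]
      have := h₂ _ hw.1
      simp only [inner_zero_left, real_inner_smul_left, inner_neg_left] at this ⊢
      linarith
    · refine ⟨(0, (-4 : ℝ) • (q₂ - q₁)), fun w hw => ?_, by simp [hd],
        by simpa [stdJ] using hasDerivAt_rectangleLoop_third h⟩
      rw [rectangleLoop_third (Ioo_subset_Icc_self h)]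
      have := h₃ _ hw.2
      rw [← neg_sub, inner_neg_left] at this
      simp only [inner_zero_left, real_inner_smul_left]
      linarith
    · refine ⟨((4 : ℝ) • (p₂ - p₁), 0), fun w hw => ?_, by simp [he],
        by simpa [stdJ] using hasDerivAt_rectangleLoop_fourth h⟩
      rw [rectangleLoop_fourth (Ioo_subset_Icc_self h)]
      have := h₄ _ hw.1
      rw [neg_sub] at this
      simp only [inner_zero_left, real_inner_smul_left]
      linarith

theorem integral_eq_of_eqOn_Ioo {f : ℝ → ℝ} {a b c : ℝ} (hab : a ≤ b)
    (h : ∀ t ∈ Ioo a b, f t = c) :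
    IntervalIntegrable f volume a b ∧ ∫ t in a..b, f t = (b - a) * c := by
  have hae : ∀ᵐ t ∂(volume.restrict (uIoc a b)), f t = c := by
    rw [uIoc_of_le hab, ← restrict_Ioo_eq_restrict_Ioc]
    filter_upwards [ae_restrict_mem measurableSet_Ioo] with t ht using h t ht
  refine ⟨(intervalIntegrable_const (c := c)).congr_ae (hae.mono fun t ht => ht.symm), ?_⟩
  rw [intervalIntegral.integral_congr_ae_restrict hae]
  simp

/-- Only the two sides on which q moves contribute. -/
theorem symplecticAction_rectangleLoop :
    symplecticAction (rectangleLoop q₁ q₂ p₁ p₂) = inner ℝ (p₁ - p₂) (q₂ - q₁) := by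
  obtain ⟨i₁, e₁⟩ := integral_eq_of_eqOn_Ioo (a := 0) (b := 1 / 4)
    (f := fun t => inner ℝ (rectangleLoop q₁ q₂ p₁ p₂ t).2 (deriv (rectangleLoop q₁ q₂ p₁ p₂) t).1)
    (c := 4 * inner ℝ p₁ (q₂ - q₁)) (by norm_num) fun t ht => by
      rw [(hasDerivAt_rectangleLoop_first ht).deriv, rectangleLoop_first (Ioo_subset_Icc_self ht),
        real_inner_smul_right]
  obtain ⟨i₂, e₂⟩ := integral_eq_of_eqOn_Ioo (a := 1 / 4) (b := 1 / 2)
    (f := fun t => inner ℝ (rectangleLoop q₁ q₂ p₁ p₂ t).2 (deriv (rectangleLoop q₁ q₂ p₁ p₂) t).1)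
    (c := 0) (by norm_num) fun t ht => by
      rw [(hasDerivAt_rectangleLoop_second ht).deriv, inner_zero_right]
  obtain ⟨i₃, e₃⟩ := integral_eq_of_eqOn_Ioo (a := 1 / 2) (b := 3 / 4)
    (f := fun t => inner ℝ (rectangleLoop q₁ q₂ p₁ p₂ t).2 (deriv (rectangleLoop q₁ q₂ p₁ p₂) t).1)
    (c := -4 * inner ℝ p₂ (q₂ - q₁)) (by norm_num) fun t ht => by
      rw [(hasDerivAt_rectangleLoop_third ht).deriv, rectangleLoop_third (Ioo_subset_Icc_self ht),
        real_inner_smul_right]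
  obtain ⟨i₄, e₄⟩ := integral_eq_of_eqOn_Ioo (a := 3 / 4) (b := 1)
    (f := fun t => inner ℝ (rectangleLoop q₁ q₂ p₁ p₂ t).2 (deriv (rectangleLoop q₁ q₂ p₁ p₂) t).1)
    (c := 0) (by norm_num) fun t ht => by
      rw [(hasDerivAt_rectangleLoop_fourth ht).deriv, inner_zero_right]
  rw [symplecticAction, ← intervalIntegral.integral_add_adjacent_intervals
    ((i₁.trans i₂).trans i₃) i₄, ← intervalIntegral.integral_add_adjacent_intervals
    (i₁.trans i₂) i₃, ← intervalIntegral.integral_add_adjacent_intervals i₁ i₂, e₁, e₂, e₃, e₄,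
    inner_sub_left]
  ring

end rectangleLoop

theorem isClosedBilliard_two {n : ℕ} {K T : Set (Euc n)} {q₁ q₂ p₁ p₂ : Euc n}
    (hq₁ : q₁ ∈ frontier K) (hq₂ : q₂ ∈ frontier K) (hp₁ : p₁ ∈ frontier T)
    (hp₂ : p₂ ∈ frontier T) (hq : q₂ ≠ q₁)
    (h₁ : q₂ - q₁ ∈ outerNormalCone T p₁) (h₂ : -(p₂ - p₁) ∈ outerNormalCone K q₂)
    (h₃ : q₁ - q₂ ∈ outerNormalCone T p₂) (h₄ : -(p₁ - p₂) ∈ outerNormalCone K q₁) :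
    IsClosedBilliard K T ![q₁, q₂] := by
  refine ⟨le_rfl, Fin.forall_fin_two.2 ⟨hq₁, hq₂⟩, Fin.forall_fin_two.2 ⟨hq, hq.symm⟩,
    ![p₁, p₂], Fin.forall_fin_two.2 ⟨hp₁, hp₂⟩, Fin.forall_fin_two.2 ⟨⟨h₁, h₂⟩, h₃, h₄⟩⟩

theorem supportFn_eq_inner {n : ℕ} {T : Set (Euc n)} {x u : Euc n} (hx : x ∈ T)
    (hu : u ∈ outerNormalCone T x) : supportFn T u = inner ℝ x u := by
  refine IsGreatest.csSup_eq ⟨⟨x, hx, rfl⟩, ?_⟩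
  rintro _ ⟨y, hy, rfl⟩
  have := hu y hy
  rw [inner_sub_right, real_inner_comm, real_inner_comm x] at this
  linarith

theorem dualLength_two {n : ℕ} {T : Set (Euc n)} {q₁ q₂ p₁ p₂ : Euc n} (hp₁ : p₁ ∈ T)
    (hp₂ : p₂ ∈ T) (h₁ : q₂ - q₁ ∈ outerNormalCone T p₁) (h₃ : q₁ - q₂ ∈ outerNormalCone T p₂) :
    dualLength T ![q₁, q₂] = inner ℝ (p₁ - p₂) (q₂ - q₁) := by
  have : dualLength T ![q₁, q₂] = supportFn T (q₂ - q₁) + supportFn T (q₁ - q₂) :=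
    Fin.sum_univ_two _
  rw [this, supportFn_eq_inner hp₁ h₁, supportFn_eq_inner hp₂ h₃, inner_sub_left,
    ← neg_sub q₂ q₁, inner_neg_right]
  ring

/-! ### The diagonals of the pentagon -/

/-- A linear functional with a local maximum at an interior point is zero. -/
theorem mem_frontier_of_mem_outerNormalCone {n : ℕ} {S : Set (Euc n)} {x u : Euc n} (hx : x ∈ S)
    (hu : u ∈ outerNormalCone S x) (hu0 : u ≠ 0) : x ∈ frontier S := by
  refine ⟨subset_closure hx, fun hint => hu0 ?_⟩
  have hmax : IsLocalMax (innerSL ℝ u) x := by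
    filter_upwards [mem_interior_iff_mem_nhds.1 hint] with y hy
    have := hu y hy
    rw [inner_sub_right] at this
    simp only [innerSL_apply_apply]
    linarith
  have h0 := hmax.hasFDerivAt_eq_zero (innerSL ℝ u).hasFDerivAt
  simpa using congrArg (fun f => f u) h0

theorem mem_outerNormalCone_convexHull {ι : Type*} {v : ι → Euc 2} {x u : Euc 2}
    (h : ∀ k, inner ℝ u (v k) ≤ inner ℝ u x) : u ∈ outerNormalCone (convexHull ℝ (range v)) x :=
  fun y hy => by
    rw [inner_sub_right]
    linarith [inner_le_of_mem_convexHull h hy]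

theorem pentagonVertex_sub_neighbours (a : Fin 5) :
    pentagonVertex (a + 1) - pentagonVertex (a - 1) = (-(2 * pentSin)) • rotatedPentagonVertex a := by
  have := pentCos_quadratic
  have := pentSin_sq
  rw [rotatedPentagonVertex_eq, pentagonVertex_eq]
  ext i
  fin_cases i <;> fin_cases a <;> simp <;> grind

/-- The point is the midpoint of the edge of T opposite w_a. -/
theorem rotatedPentagonVertex_opposite_midpoint_mem (a : Fin 5) :
    (-(pentCos + 1 / 2)) • rotatedPentagonVertex a ∈ pentagonT := by
  have hq := pentCos_quadratic
  have hss := pentSin_sq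
  have e : (-(pentCos + 1 / 2)) • rotatedPentagonVertex a =
      (1 / 2 : ℝ) • rotatedPentagonVertex (a + 2) + (1 / 2 : ℝ) • rotatedPentagonVertex (a + 3) := by
    simp only [rotatedPentagonVertex_eq]
    rw [pentagonVertex_eq]
    ext i
    fin_cases i <;> fin_cases a <;> simp <;> grind
  rw [e]
  exact convex_pentagonT (rotatedPentagonVertex_mem _) (rotatedPentagonVertex_mem _)
    (by norm_num) (by norm_num) (by norm_num)

theorem rotatedPentagonVertex_ne_zero (a : Fin 5) : rotatedPentagonVertex a ≠ 0 := fun h => by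
  have := inner_rotatedPentagonVertex a a
  rw [inner_pentagonVertex_self, h, inner_zero_left] at this
  norm_num at this

theorem smul_mem_outerNormalCone_pentagonT (a : Fin 5) {m : ℝ} (hm : 0 ≤ m) :
    m • rotatedPentagonVertex a ∈ outerNormalCone pentagonT (rotatedPentagonVertex a) :=
  mem_outerNormalCone_convexHull fun k => by
    rw [real_inner_smul_left, real_inner_smul_left, inner_rotatedPentagonVertex,
      inner_rotatedPentagonVertex, inner_pentagonVertex_self]
    exact mul_le_mul_of_nonneg_left (inner_pentagonVertex_le_one a k) hm

theorem neg_smul_mem_outerNormalCone_pentagonT (a : Fin 5) {m : ℝ} (hm : 0 ≤ m) :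
    (-m) • rotatedPentagonVertex a ∈
      outerNormalCone pentagonT ((-(pentCos + 1 / 2)) • rotatedPentagonVertex a) :=
  mem_outerNormalCone_convexHull fun k => by
    rw [real_inner_smul_left, real_inner_smul_left, real_inner_smul_right,
      inner_rotatedPentagonVertex, inner_rotatedPentagonVertex, inner_pentagonVertex_self]
    have := mul_le_mul_of_nonneg_left (le_inner_pentagonVertex a k) hm
    linarith

theorem inner_pentagonVertex_neighbours (a : Fin 5) :
    inner ℝ (pentagonVertex (a - 1)) (pentagonVertex (a + 1)) = -(pentCos + 1 / 2) := by
  have h : ∀ a : Fin 5, a - 1 + 2 = a + 1 := by decide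
  rw [← h, inner_pentagonVertex_add_two]

/-- The vector is a nonnegative multiple of v_{a+1} - v_{a-1}. On K, ⟨v_{a+1}, ·⟩ is largest and
⟨v_{a-1}, ·⟩ smallest at v_{a+1}. -/
theorem neg_smul_mem_outerNormalCone_pentagonK (a : Fin 5) {m : ℝ} (hm : 0 ≤ m) :
    (-m) • rotatedPentagonVertex a ∈ outerNormalCone pentagonK (pentagonVertex (a + 1)) := by
  have hs := pentSin_pos
  have e : (-m) • rotatedPentagonVertex a =
      (m / (2 * pentSin)) • (pentagonVertex (a + 1) - pentagonVertex (a - 1)) := by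
    rw [pentagonVertex_sub_neighbours, smul_smul]
    congr 1
    field_simp
  refine mem_outerNormalCone_convexHull fun k => ?_
  rw [e, real_inner_smul_left, real_inner_smul_left]
  refine mul_le_mul_of_nonneg_left ?_ (by positivity)
  rw [inner_sub_left, inner_sub_left, inner_pentagonVertex_self, inner_pentagonVertex_neighbours]
  linarith [inner_pentagonVertex_le_one (a + 1) k, le_inner_pentagonVertex (a - 1) k]

theorem smul_mem_outerNormalCone_pentagonK (a : Fin 5) {m : ℝ} (hm : 0 ≤ m) :
    m • rotatedPentagonVertex a ∈ outerNormalCone pentagonK (pentagonVertex (a - 1)) := by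
  have hs := pentSin_pos
  have e : m • rotatedPentagonVertex a =
      (m / (2 * pentSin)) • (pentagonVertex (a - 1) - pentagonVertex (a + 1)) := by
    rw [← neg_sub, pentagonVertex_sub_neighbours, ← neg_smul, smul_smul]
    congr 1
    field_simp
  refine mem_outerNormalCone_convexHull fun k => ?_
  rw [e, real_inner_smul_left, real_inner_smul_left]
  refine mul_le_mul_of_nonneg_left ?_ (by positivity)
  rw [inner_sub_left, inner_sub_left, inner_pentagonVertex_self, real_inner_comm,
    real_inner_comm (pentagonVertex (a - 1)) (pentagonVertex (a + 1)),
    inner_pentagonVertex_neighbours]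
  linarith [inner_pentagonVertex_le_one (a - 1) k, le_inner_pentagonVertex (a + 1) k,
    real_inner_comm (pentagonVertex (a - 1)) (pentagonVertex k)]

theorem pentagonVertex_mem_frontier (k : Fin 5) : pentagonVertex k ∈ frontier pentagonK := by
  refine mem_frontier_of_mem_outerNormalCone (u := pentagonVertex k) (pentagonVertex_mem k)
    (mem_outerNormalCone_convexHull fun j => ?_) fun h => ?_
  · rw [inner_pentagonVertex_self]
    exact inner_pentagonVertex_le_one k j
  · have := inner_pentagonVertex_self k
    rw [h, inner_zero_left] at this
    norm_num at this

/-- The bounce data of a diagonal: a diagonal is a two-bounce trajectory in both directions, and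
it carries a closed characteristic whose action is its length. -/
theorem diagonal_bounce (a : Fin 5) :
    let q₁ := pentagonVertex (a - 1)
    let q₂ := pentagonVertex (a + 1)
    let p₁ := (-(pentCos + 1 / 2)) • rotatedPentagonVertex a
    let p₂ := rotatedPentagonVertex a
    (p₁ ∈ frontier pentagonT ∧ p₂ ∈ frontier pentagonT ∧ q₂ ≠ q₁ ∧ p₂ ≠ p₁) ∧
      q₂ - q₁ ∈ outerNormalCone pentagonT p₁ ∧ -(p₂ - p₁) ∈ outerNormalCone pentagonK q₂ ∧
      q₁ - q₂ ∈ outerNormalCone pentagonT p₂ ∧ -(p₁ - p₂) ∈ outerNormalCone pentagonK q₁ ∧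
      inner ℝ (p₁ - p₂) (q₂ - q₁) = 2 * pentSin * (3 / 2 + pentCos) := by
  have hs := pentSin_pos
  have hc := pentCos_pos
  have hw := rotatedPentagonVertex_ne_zero a
  intro q₁ q₂ p₁ p₂
  -- All displacements, in q and in p, are multiples of the unit vector w_a.
  have hd : q₂ - q₁ = (-(2 * pentSin)) • p₂ := pentagonVertex_sub_neighbours a
  have hd' : q₁ - q₂ = (2 * pentSin) • p₂ := by rw [← neg_sub, hd, neg_smul, neg_neg]
  have he : p₁ - p₂ = (-(3 / 2 + pentCos)) • p₂ := by
    simp only [p₁]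
    module
  have he' : p₂ - p₁ = (3 / 2 + pentCos) • p₂ := by rw [← neg_sub, he, neg_smul, neg_neg]
  refine ⟨⟨?_, ?_, ?_, ?_⟩, ?_, ?_, ?_, ?_, ?_⟩
  · exact mem_frontier_of_mem_outerNormalCone (rotatedPentagonVertex_opposite_midpoint_mem a)
      (neg_smul_mem_outerNormalCone_pentagonT a zero_le_one) (by simpa using hw)
  · exact mem_frontier_of_mem_outerNormalCone (rotatedPentagonVertex_mem a)
      (smul_mem_outerNormalCone_pentagonT a zero_le_one) (by simpa using hw)
  · rw [← sub_ne_zero, hd]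
    exact smul_ne_zero (by linarith) hw
  · rw [← sub_ne_zero, he']
    exact smul_ne_zero (by linarith) hw
  · rw [hd]
    exact neg_smul_mem_outerNormalCone_pentagonT a (by linarith)
  · rw [neg_sub, he]
    exact neg_smul_mem_outerNormalCone_pentagonK a (by linarith)
  · rw [hd']
    exact smul_mem_outerNormalCone_pentagonT a (by linarith)
  · rw [neg_sub, he']
    exact smul_mem_outerNormalCone_pentagonK a (by linarith)
  · rw [hd, he, real_inner_smul_left, real_inner_smul_right, inner_rotatedPentagonVertex,
      inner_pentagonVertex_self]
    ring

theorem isLeast_characteristicActions_pentagon :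
    IsLeast (characteristicActions (lagrangianProduct pentagonK pentagonT))
      (2 * pentSin * (3 / 2 + pentCos)) := by
  refine ⟨?_, ?_⟩
  · obtain ⟨⟨hp₁, hp₂, hq, hp⟩, h₁, h₂, h₃, h₄, hact⟩ := diagonal_bounce 0
    exact ⟨_, isGenClosedCharacteristic_rectangleLoop convex_pentagonK convex_pentagonT
      isClosed_pentagonK isClosed_pentagonT (pentagonVertex_mem_frontier _)
      (pentagonVertex_mem_frontier _) hp₁ hp₂ hq hp h₁ h₂ h₃ h₄,
      symplecticAction_rectangleLoop.trans hact⟩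
  · rintro _ ⟨γ, hγ, rfl⟩
    exact hγ.pentagon_le_symplecticAction

theorem proposition1p2 :
    -- the minimum that defines the capacity is attained
    IsLeast (characteristicActions (lagrangianProduct pentagonK pentagonT))
      (ehzCapacity (lagrangianProduct pentagonK pentagonT)) ∧
    -- for all distinct non-adjacent vertices `i`, `j`, that is, along every diagonal of `K`
    (∀ i j : Fin 5, i ≠ j → j ≠ i + 1 → i ≠ j + 1 →
      IsClosedBilliard pentagonK pentagonT ![pentagonVertex i, pentagonVertex j] ∧
      ehzCapacity (lagrangianProduct pentagonK pentagonT) =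
        dualLength pentagonT ![pentagonVertex i, pentagonVertex j]) ∧
    ehzCapacity (lagrangianProduct pentagonK pentagonT) =
      2 * Real.cos (Real.pi / 10) * (1 + Real.cos (Real.pi / 5)) := by
  have hcap : ehzCapacity (lagrangianProduct pentagonK pentagonT) =
      2 * pentSin * (3 / 2 + pentCos) := isLeast_characteristicActions_pentagon.csInf_eq
  rw [hcap]
  refine ⟨isLeast_characteristicActions_pentagon, fun i j hij hij' hji => ?_, ?_⟩
  -- The ends of a diagonal are the two neighbours of a vertex v_a; reversing the diagonal exchanges
  -- the two momenta.
  · obtain ⟨a, ha⟩ : ∃ a : Fin 5, (i = a - 1 ∧ j = a + 1) ∨ (i = a + 1 ∧ j = a - 1) := by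
      revert i j; decide
    obtain ⟨⟨hp₁, hp₂, hq, hp⟩, h₁, h₂, h₃, h₄, hact⟩ := diagonal_bounce a
    have f₁ := pentagonVertex_mem_frontier (a - 1)
    have f₂ := pentagonVertex_mem_frontier (a + 1)
    have m₁ := isClosed_pentagonT.frontier_subset hp₁
    have m₂ := isClosed_pentagonT.frontier_subset hp₂
    rcases ha with ⟨rfl, rfl⟩ | ⟨rfl, rfl⟩
    · exact ⟨isClosedBilliard_two f₁ f₂ hp₁ hp₂ hq h₁ h₂ h₃ h₄,
        hact.symm.trans (dualLength_two m₁ m₂ h₁ h₃).symm⟩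
    · refine ⟨isClosedBilliard_two f₂ f₁ hp₂ hp₁ hq.symm h₃ h₄ h₁ h₂, ?_⟩
      rw [dualLength_two m₂ m₁ h₃ h₁, ← hact, ← neg_sub, ← neg_sub (pentagonVertex (a - 1)),
        inner_neg_neg]
  · rw [cos_pi_div_ten_eq_pentSin, cos_pi_div_five_eq_pentCos]
    ring
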